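/- A \emph{signature} $\Sigma$ is a set of operation symbols $f$ with arities $\mathrm{ar}(f)\in\mathbb N$; \emph{programs} are closed $\Sigma$-terms. Let $S$ be a set of states. A \emph{Stateful SOS specification} $\mathcal L$ over $(\Sigma,S)$ consists, for each $n$-ary $f\in\Sigma$, each input state $s\in S$ and each choice of premisses $l_1,\dots,l_n$, where $l_j$ is either progressing ($s,x_j\to s_j',y_j$) or terminating ($s,x_j\downarrow s_j'$) with $s_j'\in S$, of exactly one rule, with conclusion either $s,f(x_1,\dots,x_n)\to s',t$ or $s,f(x_1,\dots,x_n)\downarrow s'$, where $s'\in S$ and $t$ is a $\Sigma$-term whose variables are among $x_1,\dots,x_n$ and those $y_j$ for which $l_j$ is progressing. By recursion on $p$, the rules determine for every state $s$ and program $p$ exactly one step, $s,p\to s',p'$ or $s,p\downarrow s'$. The \emph{trace semantics} maps a program $p$ to the function that sends $s\in S$ to the finite or infinite sequence $s_1s_2s_3\cdots$ of states of the run $s,p\to s_1,p_1\to s_2,p_2\to\cdots$ (if the run ends with $s_k,p_k\downarrow s_{k+1}$, the last entry is $s_{k+1}$). The \emph{termination semantics} maps $p$ to the function that sends $s$ to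 the last entry of this sequence if it is finite, and to $\bot$ otherwise. A semantics $\llbracket-\rrbracket$ of programs is \emph{compositional} if, for each $n$-ary $f\in\Sigma$, $\llbracket p_i\rrbracket=\llbracket q_i\rrbracket$ for $i=1,\dots,n$ implies $\llbracket f(p_1,\dots,p_n)\rrbracket=\llbracket f(q_1,\dots,q_n)\rrbracket$. A specification is \emph{primitive recursive} if the operation symbols and the states form primitive recursive subsets of $\mathbb N$, the arity function is primitive recursive, and so is, under a standard encoding of terms as finite strings, the function that assigns to an operation symbol, an input state and a list of premisses the output state and the target (if any) of the conclusion of the respective rule. As an input of an algorithm it is given by primitive recursive definitions of these four functions. \textbf{Theorem.} It is undecidable whether the trace semantics of a primitive recursive Stateful SOS specification is compositional, and it is undecidable whether the termination semantics of a primitive recursive Stateful SOS specification is compositional. That is, for neither of the two properties is there an algorithm that, for every primitive recursive specification given as input, halts and correctly answers whether the specification has the property. -/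

import Mathlib

namespace SSOS

/-! ### Signatures and terms -/

/-- An algebraic signature: a type of operation symbols, each with a finite arity. -/
structure Signature where
  Op : Type
  ar : Op → ℕ

/-- Terms over the signature `A` with variables from `V`. -/
inductive Term (A : Signature) (V : Type) : Type where
  | var : V → Term A V
  | op : (f : A.Op) → (Fin (A.ar f) → Term A V) → Term A V

/-- Programs are closed terms. -/
abbrev Program (A : Signature) : Type := Term A Empty

/-- Simultaneous substitution of terms for variables. -/
def Term.subst {A : Signature} {V W : Type} (σ : V → Term A W) : Term A V → Term A W
  | .var v => σ v
  | .op f ts => .op f (fun j => (ts j).subst σ)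

/-! ### Stateful SOS specifications -/

/-- The premisses of a rule for an `n`-ary operator, up to the (common) input state: the `j`-th
premiss has output state `(τ j).1`, and it is progressing (`s, x_j → s', y_j`) if `(τ j).2 = true`
and terminating (`s, x_j ↓ s'`) if `(τ j).2 = false`. -/
abbrev Premisses (S : Type) (n : ℕ) : Type := Fin n → S × Bool

/-- The variables that may occur in the target of the conclusion of a rule with premisses `τ`:
the sources `x_j` (`Sum.inl j`) of all premisses and the targets `y_j` (`Sum.inr j`) of the
progressing ones. -/
abbrev RuleVar {S : Type} {n : ℕ} (τ : Premisses S n) : Type :=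
  Fin n ⊕ {j : Fin n // (τ j).2 = true}

/-- A Stateful SOS specification over the signature `A` with state set `S`: for every operator `f`,
input state `s` and premisses `τ` (that is, for every trigger) there is exactly one rule, and
`rule f s τ` is its conclusion: `(s', some t)` stands for the progressing conclusion
`s, f(x_1, …, x_n) → s', t`, and `(s', none)` for the terminating conclusion
`s, f(x_1, …, x_n) ↓ s'`. -/
structure Spec (A : Signature) (S : Type) where
  rule : (f : A.Op) → (s : S) → (τ : Premisses S (A.ar f)) → S × Option (Term A (RuleVar τ))

namespace Spec

variable {A : Signature} {S : Type}

/-- The transition function of a specification: `L.step s p` is `(s', some p')` if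
`s, p → s', p'`, and `(s', none)` if `s, p ↓ s'`. -/
def step (L : Spec A S) (s : S) : Program A → S × Option (Program A)
  | .var v => v.elim
  | .op f ts =>
    let d : Fin (A.ar f) → S × Option (Program A) := fun j => L.step s (ts j)
    let τ : Premisses S (A.ar f) := fun j => ((d j).1, (d j).2.isSome)
    let r : S × Option (Term A (RuleVar τ)) := L.rule f s τ
    (r.1, r.2.map (Term.subst (Sum.elim ts (fun j => (d j.1).2.get j.2))))

/-- Trace semantics: `L.trace p s` is the finite or infinite sequence `s₁ s₂ s₃ …` of states of the
run `s, p → s₁, p₁ → s₂, p₂ → …`; if the run ends with a step `s_k, p_k ↓ s'`, then `s'` is the last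
entry. This is the unique coalgebra homomorphism from the transition system on `S × Program A` to
the non-empty possibly terminating streams. -/
def trace (L : Spec A S) (p : Program A) (s : S) : Stream'.Seq S :=
  Stream'.Seq.corec
    (fun c : Option (S × Program A) => c.map fun sp =>
      ((L.step sp.1 sp.2).1,
        (L.step sp.1 sp.2).2.map fun p' => ((L.step sp.1 sp.2).1, p')))
    (some (s, p))

/-- The trace is a homomorphism into the coalgebra of possibly terminating streams. -/
theorem trace_destruct (L : Spec A S) (p : Program A) (s : S) :
    (L.trace p s).destruct = some ((L.step s p).1,
      match (L.step s p).2 with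
      | none => Stream'.Seq.nil
      | some p' => L.trace p' (L.step s p).1) := by
  simp only [trace, Stream'.Seq.corec_eq]
  simp only [Option.map_some, Stream'.Seq.omap]
  congr 2
  cases h : (L.step s p).2 with
  | none => apply Stream'.Seq.destruct_eq_none; simp [Stream'.Seq.corec_eq]; rfl
  | some p' => rfl

end Spec

open Classical in
/-- The last element of a finite non-empty sequence; `none` (which stands for divergence) if the
sequence is infinite. -/
noncomputable def finalState {S : Type} (x : Stream'.Seq S) : Option S :=
  if h : x.Terminates then x.get? (x.length h - 1) else none

namespace Spec

variable {A : Signature} {S : Type}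

/-- Termination semantics: `L.termination p s` is `some s'` if the program `p`, run from the state
`s`, terminates in the final state `s'`, and `none` if it does not terminate. -/
noncomputable def termination (L : Spec A S) (p : Program A) (s : S) : Option S :=
  finalState (L.trace p s)

end Spec

/-- A semantics of programs is compositional if the induced equivalence is a congruence. -/
def Compositional {A : Signature} {D : Type} (sem : Program A → D) : Prop :=
  ∀ (f : A.Op) (p q : Fin (A.ar f) → Program A),
    (∀ j, sem (p j) = sem (q j)) → sem (.op f p) = sem (.op f q)

/-! ### Primitive recursive specifications -/

/-- A program code without unbounded search, i.e. a definition of a primitive recursive function: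
the remaining constructors are those of `Nat.Primrec`. -/
def SearchFree : Nat.Partrec.Code → Prop
  | .zero => True
  | .succ => True
  | .left => True
  | .right => True
  | .pair a b => SearchFree a ∧ SearchFree b
  | .comp a b => SearchFree a ∧ SearchFree b
  | .prec a b => SearchFree a ∧ SearchFree b
  | .rfind' _ => False

/-- A primitive recursive function together with a primitive recursive definition of it. -/
structure PrimrecDefinition where
  code : Nat.Partrec.Code
  searchFree : SearchFree code
  toFun : ℕ → ℕ
  eval_eq : ∀ n, code.eval n = Part.some (toFun n)

/-- The signature whose operation symbols are the natural numbers `f` with `isOp f ≠ 0`; the arity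
of `f` is `ar f`. -/
def natSignature (isOp ar : ℕ → ℕ) : Signature where
  Op := {f : ℕ // isOp f ≠ 0}
  ar f := ar f.1

/-- The set of states consisting of the natural numbers `s` with `isState s ≠ 0`. -/
abbrev NatState (isState : ℕ → ℕ) : Type := {s : ℕ // isState s ≠ 0}

/-- The encoding of the targets of rules as finite strings over `ℕ`, in Polish (prefix) notation:
the letters for `x_j`, `y_j` and the operation symbol `f` are `3 j`, `3 j + 1` and `3 f + 2`
(with the indices `j` counted from `0`). -/
def encodeTarget {isOp ar : ℕ → ℕ} {S : Type} {n : ℕ} {τ : Premisses S n} :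
    Term (natSignature isOp ar) (RuleVar τ) → List ℕ
  | .var (.inl j) => [3 * (j : ℕ)]
  | .var (.inr j) => [3 * (j.1 : ℕ) + 1]
  | .op f ts => (3 * f.1 + 2) :: (List.ofFn fun j => encodeTarget (ts j)).flatten

/-- Polish notation is prefix-free and uniquely readable. -/
theorem encodeTarget_append_injective {isOp ar : ℕ → ℕ} {S : Type} {n : ℕ} {τ : Premisses S n}
    (t t' : Term (natSignature isOp ar) (RuleVar τ)) (u u' : List ℕ)
    (h : encodeTarget t ++ u = encodeTarget t' ++ u') : t = t' ∧ u = u' := by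
  induction t generalizing t' u u' with
  | var v =>
    rcases v with j | j <;> rcases t' with (j' | j') | ⟨f', ts'⟩ <;>
      simp only [encodeTarget, List.cons_append, List.nil_append, List.cons.injEq] at h
    · obtain ⟨h1, h2⟩ := h
      have : j = j' := by ext; omega
      simp [this, h2]
    · omega
    · omega
    · omega
    · obtain ⟨h1, h2⟩ := h
      have : j = j' := by ext; omega
      simp [this, h2]
    · omega
  | op f ts ih =>
    rcases t' with (j' | j') | ⟨f', ts'⟩ <;>
      simp only [encodeTarget, List.cons_append, List.nil_append, List.cons.injEq] at h
    · omega
    · omega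
    · obtain ⟨h1, h2⟩ := h
      have hf : f = f' := Subtype.ext (by omega)
      subst hf
      have key : ∀ (m : ℕ) (a b : Fin m → Term (natSignature isOp ar) (RuleVar τ)),
          (∀ (j : Fin m) (t' : Term (natSignature isOp ar) (RuleVar τ)) (u u' : List ℕ),
            encodeTarget (a j) ++ u = encodeTarget t' ++ u' → a j = t' ∧ u = u') →
          (List.ofFn fun j => encodeTarget (a j)).flatten ++ u =
            (List.ofFn fun j => encodeTarget (b j)).flatten ++ u' → a = b ∧ u = u' := by
        intro m
        induction m with
        | zero => intro a b _ h; exact ⟨funext fun j => j.elim0, by simpa using h⟩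
        | succ m ihm =>
          intro a b hab h
          simp only [List.ofFn_succ, List.flatten_cons, List.append_assoc] at h
          obtain ⟨h0, h3⟩ := hab 0 _ _ _ h
          obtain ⟨h4, h5⟩ := ihm (fun j => a j.succ) (fun j => b j.succ)
            (fun j => hab j.succ) h3
          refine ⟨funext fun j => ?_, h5⟩
          refine Fin.cases h0 (fun i => ?_) j
          exact congrFun h4 i
      obtain ⟨h3, h4⟩ := key _ ts ts' ih h2
      exact ⟨by rw [h3], h4⟩

/-- Targets are determined by their encodings. -/
theorem encodeTarget_injective {isOp ar : ℕ → ℕ} {S : Type} {n : ℕ} {τ : Premisses S n} :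
    Function.Injective
      (encodeTarget : Term (natSignature isOp ar) (RuleVar τ) → List ℕ) := fun t t' h =>
  (encodeTarget_append_injective t t' [] [] (by rw [h])).1

/-- The encoding of an operation symbol, an input state and a list of premisses. -/
def encodeTrigger {isState : ℕ → ℕ} {n : ℕ} (f : ℕ) (s : NatState isState)
    (τ : Premisses (NatState isState) n) : ℕ :=
  Encodable.encode (f, s.1, List.ofFn fun j => ((τ j).1.1, (τ j).2))

/-- The encoding of the conclusion of a rule. -/
def encodeConclusion {isOp ar isState : ℕ → ℕ} {n : ℕ} {τ : Premisses (NatState isState) n}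
    (r : NatState isState × Option (Term (natSignature isOp ar) (RuleVar τ))) : ℕ :=
  Encodable.encode (r.1.1, r.2.map encodeTarget)

/-- A primitive recursive Stateful SOS specification: the set of operation symbols, the arities, the
set of states, and the function that assigns to an operation symbol, an input state and a list of
premisses the conclusion of the corresponding rule are given by primitive recursive definitions. -/
structure PrimrecSpec where
  isOp : PrimrecDefinition
  ar : PrimrecDefinition
  isState : PrimrecDefinition
  ruleFun : PrimrecDefinition
  spec : Spec (natSignature isOp.toFun ar.toFun) (NatState isState.toFun)
  ruleFun_eq : ∀ (f : (natSignature isOp.toFun ar.toFun).Op) (s : NatState isState.toFun)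
    (τ : Premisses (NatState isState.toFun) ((natSignature isOp.toFun ar.toFun).ar f)),
    ruleFun.toFun (encodeTrigger f.1 s τ) = encodeConclusion (spec.rule f s τ)

/-- Finite descriptions of primitive recursive specifications: quadruples of program codes. -/
abbrev Description : Type :=
  Nat.Partrec.Code × Nat.Partrec.Code × Nat.Partrec.Code × Nat.Partrec.Code

/-- The finite description of a primitive recursive specification. -/
def PrimrecSpec.description (P : PrimrecSpec) : Description :=
  (P.isOp.code, P.ar.code, P.isState.code, P.ruleFun.code)

/-- The finite description of a primitive recursive specification determines the specification. -/
theorem PrimrecSpec.description_injective : Function.Injective PrimrecSpec.description := by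
  have hd : ∀ a b : PrimrecDefinition, a.code = b.code → a = b := by
    rintro ⟨c, h1, F, h2⟩ ⟨c', h1', F', h2'⟩ (rfl : c = c')
    have : F = F' := funext fun n => Part.some_injective ((h2 n).symm.trans (h2' n))
    subst this; rfl
  rintro ⟨o, a, st, r, ⟨L⟩, hL⟩ ⟨o', a', st', r', ⟨L'⟩, hL'⟩ h
  simp only [PrimrecSpec.description, Prod.mk.injEq] at h
  obtain ⟨h1, h2, h3, h4⟩ := h
  obtain rfl := hd _ _ h1
  obtain rfl := hd _ _ h2
  obtain rfl := hd _ _ h3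
  obtain rfl := hd _ _ h4
  have : L = L' := by
    funext f s τ
    have h := (hL f s τ).symm.trans (hL' f s τ)
    have h := Encodable.encode_injective h
    simp only [Prod.mk.injEq] at h
    exact Prod.ext (Subtype.ext h.1) (Option.map_injective encodeTarget_injective h.2)
  subst this; rfl

/-- A property of primitive recursive specifications is decidable if some algorithm that gets the
finite description of a primitive recursive specification always answers, and correctly. On inputs
that do not describe a specification the algorithm may do anything, including run forever. -/
def DecidableForSpecs (Q : PrimrecSpec → Prop) : Prop :=
  ∃ d : Description →. Bool, Partrec d ∧
    ∀ P : PrimrecSpec, ∃ b : Bool, b ∈ d P.description ∧ (b = true ↔ Q P)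

end SSOS

/-! Divergence of a code `c` on input 0 reduces to compositionality. Whether `c` halts is hidden in
how a program behaves from states it never reaches on its own. The constants `simConst 2` and
`simConst 3` both move to state 0 and continue as `simConst 0`, which ends in 0, and as `simConst
1`, which from state `s` ends in 1 if `c` halts within bound `s` and in 0 otherwise. Bound 0 never
suffices, so both constants have the trace 0, 0 from every state (`trace_simConst_two`). The unary
symbol puts the input state `s` back after the first step of its argument and so runs the
continuation from `s`: if `c` halts, a large `s` separates the final states
(`termination_simReset_ne`).

If `c` diverges, every program ends in state 0 after one or two steps (`step_of_not_dom`). The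
termination semantics is then constant, and the trace of `simReset p` from `s` is 0 or `s`, 0,
according to the length of the trace of `p`.

Only bounded runs of `c` enter the rules, so these are primitive recursive, and a description is
computable from `c`. -/

namespace SSOS

open Nat.Partrec (Code)
open Encodable

/-! ### Primitive recursive definitions -/

/-- Every primitive recursive function has a definition without unbounded search. -/
theorem exists_searchFree_code {f : ℕ → ℕ} (hf : Nat.Primrec f) :
    ∃ c : Code, SearchFree c ∧ ∀ n, c.eval n = Part.some (f n) := by
  induction hf with
  | zero => exact ⟨.zero, trivial, fun _ => rfl⟩
  | succ => exact ⟨.succ, trivial, fun _ => rfl⟩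
  | left => exact ⟨.left, trivial, fun _ => rfl⟩
  | right => exact ⟨.right, trivial, fun _ => rfl⟩
  | pair _ _ iha ihb =>
    obtain ⟨a, ha, ea⟩ := iha
    obtain ⟨b, hb, eb⟩ := ihb
    exact ⟨.pair a b, ⟨ha, hb⟩, fun n => by simp [Code.eval, ea, eb, Seq.seq]⟩
  | comp _ _ iha ihb =>
    obtain ⟨a, ha, ea⟩ := iha
    obtain ⟨b, hb, eb⟩ := ihb
    exact ⟨.comp a b, ⟨ha, hb⟩, fun n => by
      change (b.eval n).bind a.eval = _
      rw [eb]; exact (Part.bind_some _ _).trans (ea _)⟩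
  | prec _ _ iha ihb =>
    obtain ⟨a, ha, ea⟩ := iha
    obtain ⟨b, hb, eb⟩ := ihb
    refine ⟨.prec a b, ⟨ha, hb⟩, fun n => ?_⟩
    -- Primitive recursion runs on the second component of a pair, and every number is a pair.
    obtain ⟨x, m, rfl⟩ : ∃ x m, n = Nat.pair x m := ⟨_, _, (Nat.pair_unpair n).symm⟩
    induction m with
    | zero => simp [ea]
    | succ m ih => rw [Code.eval_prec_succ, ih]; simp [eb]

theorem searchFree_const (n : ℕ) : SearchFree (Code.const n) := by
  induction n with
  | zero => trivial
  | succ n ih => exact ⟨trivial, ih⟩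

theorem searchFree_curry {c : Code} (hc : SearchFree c) (n : ℕ) : SearchFree (c.curry n) :=
  ⟨hc, searchFree_const n, trivial, trivial⟩

/-! ### A specification that simulates a program code

All natural numbers are operation symbols and states. The symbol `0` is unary: it resets the state
to the input state after the first step of its argument. The other symbols are constants: `1`
terminates in the state `0`, `2` reports whether the simulated code halts within a number of steps
given by the input state, and `3` and the symbols above it reset the state to `0` and then behave
as `1` and `2`, respectively. -/

/-- `1` if the code `c` halts on input `0` within the time bound `s`, and `0` otherwise. -/
def haltsWithin (c : Code) (s : ℕ) : ℕ :=
  bif (c.evaln s 0).isSome then 1 else 0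

/-- This makes the two constants indistinguishable once they have moved to state 0. -/
theorem haltsWithin_zero (c : Code) : haltsWithin c 0 = 0 := by
  simp [haltsWithin, Code.evaln]

theorem haltsWithin_eq_zero {c : Code} (hc : ¬ (c.eval 0).Dom) (s : ℕ) : haltsWithin c s = 0 := by
  cases h : c.evaln s 0 with
  | none => simp [haltsWithin, h]
  | some x => exact absurd (Part.dom_iff_mem.2 ⟨x, Code.evaln_sound h⟩) hc

theorem exists_haltsWithin_eq_one {c : Code} (hc : (c.eval 0).Dom) :
    ∃ s, haltsWithin c s = 1 := by
  obtain ⟨s, hs⟩ := Code.evaln_complete.1 (Part.get_mem hc)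
  exact ⟨s, by rw [haltsWithin, Option.mem_def.1 hs]; rfl⟩

/-- The rules of the simulating specification on encodings. -/
def simRule (c : Code) (x : ℕ × ℕ × List (ℕ × Bool)) : ℕ × Option (List ℕ) :=
  if x.1 = 0 then
    -- The letter 1 is the target variable of the only premiss. The default `false` covers an empty
    -- premiss list, which no trigger of the unary symbol has.
    bif (x.2.2.head?.map Prod.snd).getD false then (x.2.1, some [1]) else (0, none)
  else if x.1 = 1 then (0, none)
  else if x.1 = 2 then (haltsWithin c x.2.1, none)
  -- The letters 5 = 3 * 1 + 2 and 8 = 3 * 2 + 2 encode the constants 1 and 2.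
  else if x.1 = 3 then (0, some [5])
  else (0, some [8])

/-- Evaluation with a bound is primitive recursive in the code and the bound jointly, unlike halting
itself. -/
theorem primrec_haltsWithin : Primrec₂ haltsWithin :=
  Primrec.cond
    (Primrec.option_isSome.comp (Code.primrec_evaln.comp
      (Primrec.pair (Primrec.pair Primrec.snd Primrec.fst) (Primrec.const 0))))
    (Primrec.const 1) (Primrec.const 0)

theorem primrec_simRule : Primrec₂ simRule := by
  have hf : Primrec fun x : Code × ℕ × ℕ × List (ℕ × Bool) => x.2.1 :=
    Primrec.fst.comp Primrec.snd
  have hs : Primrec fun x : Code × ℕ × ℕ × List (ℕ × Bool) => x.2.2.1 :=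
    Primrec.fst.comp (Primrec.snd.comp Primrec.snd)
  have hl : Primrec fun x : Code × ℕ × ℕ × List (ℕ × Bool) => x.2.2.2 :=
    Primrec.snd.comp (Primrec.snd.comp Primrec.snd)
  have eq (n : ℕ) : PrimrecPred fun x : Code × ℕ × ℕ × List (ℕ × Bool) => x.2.1 = n :=
    Primrec.eq.comp hf (Primrec.const n)
  have hb : Primrec fun x : Code × ℕ × ℕ × List (ℕ × Bool) =>
      (x.2.2.2.head?.map Prod.snd).getD false :=
    Primrec.option_getD.comp
      (Primrec.option_map (Primrec.list_head?.comp hl) (Primrec.snd.comp Primrec.snd).to₂)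
      (Primrec.const false)
  exact Primrec.ite (eq 0)
    (Primrec.cond hb (Primrec.pair hs (Primrec.const (some [1]))) (Primrec.const (0, none)))
    (Primrec.ite (eq 1) (Primrec.const (0, none))
    (Primrec.ite (eq 2)
      (Primrec.pair (primrec_haltsWithin.comp Primrec.fst hs) (Primrec.const none))
    (Primrec.ite (eq 3) (Primrec.const (0, some [5])) (Primrec.const (0, some [8])))))

/-- The rules of the simulating specification as a function of natural numbers, the first component
of the argument being the encoding of the simulated code. -/
def simRuleNat (n : ℕ) : ℕ :=
  (((decode n : Option (Code × ℕ × ℕ × List (ℕ × Bool))).map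
    fun x => encode (simRule x.1 x.2))).getD 0

theorem primrec_simRuleNat : Nat.Primrec simRuleNat :=
  Primrec.nat_iff.1 <| Primrec.option_getD.comp
    (Primrec.option_map Primrec.decode (Primrec.encode.comp
      (primrec_simRule.comp (Primrec.fst.comp Primrec.snd) (Primrec.snd.comp Primrec.snd))).to₂)
    (Primrec.const 0)

theorem simRuleNat_pair (c : Code) (x : ℕ × ℕ × List (ℕ × Bool)) :
    simRuleNat (Nat.pair (encode c) (encode x)) = encode (simRule c x) := by
  rw [simRuleNat, ← encode_prod_val, encodek]; rfl

/-- The signature with a unary symbol `0` and all other natural numbers as constants. -/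
abbrev simSignature : Signature := natSignature (fun _ => 1) (fun n => 1 - n)

/-- A natural number as an operation symbol. -/
abbrev simOp (n : ℕ) : simSignature.Op := ⟨n, one_ne_zero⟩

/-- The set of states: all natural numbers. -/
abbrev SimState : Type := NatState fun _ => 1

/-- A natural number as a state. -/
abbrev simState (n : ℕ) : SimState := ⟨n, one_ne_zero⟩

/-- For variable `n` the truncated difference `1 - (n + 1)` does not reduce to 0, so this needs a
proof. The arity of the symbol 0 does reduce to 1, so `(0 : Fin 1)` can serve as its argument
position. -/
theorem simSignature_ar_succ {n : ℕ} (h : 1 ≠ 0) : simSignature.ar ⟨n + 1, h⟩ = 0 :=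
  Nat.sub_eq_zero_of_le (Nat.le_add_left 1 n)

instance {n : ℕ} {h : 1 ≠ 0} : IsEmpty (Fin (simSignature.ar ⟨n + 1, h⟩)) := by
  rw [simSignature_ar_succ]; infer_instance

/-- The constant `n + 1` as a term. -/
def simConst {V : Type} (n : ℕ) : Term simSignature V :=
  .op (simOp (n + 1)) isEmptyElim

theorem op_succ_eq_simConst {V : Type} {n : ℕ} (h : 1 ≠ 0)
    (ts : Fin (simSignature.ar ⟨n + 1, h⟩) → Term simSignature V) :
    Term.op (A := simSignature) ⟨n + 1, h⟩ ts = simConst n :=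
  congrArg _ (Subsingleton.elim _ _)

/-- The unary symbol applied to a term. -/
def simReset {V : Type} (t : Term simSignature V) : Term simSignature V :=
  .op (simOp 0) fun _ => t

theorem eq_simReset {V : Type} (ts : Fin (simSignature.ar (simOp 0)) → Term simSignature V) :
    Term.op (simOp 0) ts = simReset (ts (0 : Fin 1)) :=
  congrArg (Term.op (simOp 0))
    (funext fun _ => congrArg ts (Subsingleton.elim (α := Fin 1) _ _))

/-- The specification that simulates the code `c`. -/
def simSpec (c : Code) : Spec simSignature SimState where
  rule
    | ⟨0, _⟩, s, τ =>
      if h : (τ (0 : Fin 1)).2 = true then (s, some (.var (.inr ⟨(0 : Fin 1), h⟩)))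
      else (simState 0, none)
    | ⟨1, _⟩, _, _ => (simState 0, none)
    | ⟨2, _⟩, s, _ => (simState (haltsWithin c s), none)
    | ⟨3, _⟩, _, _ => (simState 0, some (simConst 0))
    | ⟨_ + 4, _⟩, _, _ => (simState 0, some (simConst 1))

theorem flatten_ofFn_of_eq_zero {α : Type*} {n : ℕ} (h : n = 0) (g : Fin n → List α) :
    (List.ofFn g).flatten = [] := by
  subst h; simp

theorem encodeTarget_simConst {n : ℕ} {τ : Premisses SimState n} (m : ℕ) :
    encodeTarget (simConst m : Term simSignature (RuleVar τ)) = [3 * (m + 1) + 2] := by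
  rw [simConst, encodeTarget, flatten_ofFn_of_eq_zero (simSignature_ar_succ one_ne_zero)]

theorem simRuleNat_encodeTrigger (c : Code) (f : simSignature.Op) (s : SimState)
    (τ : Premisses SimState (simSignature.ar f)) :
    simRuleNat (Nat.pair (encode c) (encodeTrigger f.1 s τ)) =
      encodeConclusion ((simSpec c).rule f s τ) := by
  rw [encodeTrigger, simRuleNat_pair, encodeConclusion]
  congr 1
  match f, τ with
  | ⟨0, _⟩, τ =>
    have h0 : (List.ofFn fun j : Fin (simSignature.ar (simOp 0)) =>
        ((τ j).1.1, (τ j).2)).head? = some ((τ (0 : Fin 1)).1.1, (τ (0 : Fin 1)).2) := rfl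
    by_cases h : (τ (0 : Fin 1)).2 = true <;> simp [simRule, h0, simSpec, h, encodeTarget]
  | ⟨1, _⟩, _ => rfl
  | ⟨2, _⟩, _ => rfl
  | ⟨3, _⟩, _ => simp [simRule, simSpec, encodeTarget_simConst]
  | ⟨n + 4, _⟩, _ => simp [simRule, simSpec, encodeTarget_simConst]

/-! ### Steps and traces -/

theorem Spec.trace_of_step_none {A : Signature} {S : Type} {L : Spec A S} {s s' : S}
    {p : Program A} (h : L.step s p = (s', none)) :
    L.trace p s = Stream'.Seq.cons s' Stream'.Seq.nil :=
  Stream'.Seq.destruct_eq_cons (by rw [L.trace_destruct, h])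

theorem Spec.trace_of_step_some {A : Signature} {S : Type} {L : Spec A S} {s s' : S}
    {p p' : Program A} (h : L.step s p = (s', some p')) :
    L.trace p s = Stream'.Seq.cons s' (L.trace p' s') :=
  Stream'.Seq.destruct_eq_cons (by rw [L.trace_destruct, h])

theorem finalState_nil_cons {S : Type} (a : S) :
    finalState (Stream'.Seq.cons a Stream'.Seq.nil) = some a := by
  have h : (Stream'.Seq.cons a Stream'.Seq.nil).Terminates := ⟨1, rfl⟩
  have hl : (Stream'.Seq.cons a Stream'.Seq.nil).length h = 1 := by
    rw [Stream'.Seq.length_cons Stream'.Seq.terminates_nil, Stream'.Seq.length_nil]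
  rw [finalState, dif_pos h, hl]; rfl

theorem finalState_cons_cons_nil {S : Type} (a b : S) :
    finalState (Stream'.Seq.cons a (Stream'.Seq.cons b Stream'.Seq.nil)) = some b := by
  have h : (Stream'.Seq.cons a (Stream'.Seq.cons b Stream'.Seq.nil)).Terminates := ⟨2, rfl⟩
  have hl : (Stream'.Seq.cons a (Stream'.Seq.cons b Stream'.Seq.nil)).length h = 2 := by
    rw [Stream'.Seq.length_cons (Stream'.Seq.terminates_cons_iff.2 Stream'.Seq.terminates_nil),
      Stream'.Seq.length_cons Stream'.Seq.terminates_nil, Stream'.Seq.length_nil]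
  rw [finalState, dif_pos h, hl]; rfl

theorem step_simReset (c : Code) (s : SimState) (p : Program simSignature) :
    (simSpec c).step s (simReset p) =
      (if ((simSpec c).step s p).2.isSome then s else simState 0, ((simSpec c).step s p).2) := by
  -- The step of `p` is generalized to an arbitrary `d`, since the type of the rule's target depends
  -- on it; then a case split is possible.
  have key (d : SimState × Option (Program simSignature)) :
      (let τ : Premisses SimState 1 := fun _ => (d.1, d.2.isSome)
        let r : SimState × Option (Term simSignature (RuleVar τ)) :=
          if h : (τ 0).2 = true then (s, some (.var (.inr ⟨0, h⟩))) else (simState 0, none)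
        (r.1, r.2.map (Term.subst (Sum.elim (fun _ => p) fun j => d.2.get j.2)))) =
      (if d.2.isSome then s else simState 0, d.2) := by
    obtain ⟨t, _ | p'⟩ := d <;> simp [Term.subst]
  exact key _

theorem step_simReset_some {c : Code} {s s' : SimState} {p p' : Program simSignature}
    (h : (simSpec c).step s p = (s', some p')) :
    (simSpec c).step s (simReset p) = (s, some p') := by
  simp [step_simReset, h]

theorem step_simReset_none {c : Code} {s s' : SimState} {p : Program simSignature}
    (h : (simSpec c).step s p = (s', none)) :
    (simSpec c).step s (simReset p) = (simState 0, none) := by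
  simp [step_simReset, h]

theorem step_simConst_zero (c : Code) (s : SimState) :
    (simSpec c).step s (simConst 0) = (simState 0, none) := rfl

theorem step_simConst_one (c : Code) (s : SimState) :
    (simSpec c).step s (simConst 1) = (simState (haltsWithin c s), none) := rfl

theorem step_simConst_two (c : Code) (s : SimState) :
    (simSpec c).step s (simConst 2) = (simState 0, some (simConst 0)) := by
  -- Substitution into the target yields the same constant with another empty family of arguments.
  exact congrArg (fun t => (simState 0, some t)) (op_succ_eq_simConst one_ne_zero _)

theorem step_simConst_add_three (c : Code) (s : SimState) (n : ℕ) :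
    (simSpec c).step s (simConst (n + 3)) = (simState 0, some (simConst 1)) := by
  exact congrArg (fun t => (simState 0, some t)) (op_succ_eq_simConst one_ne_zero _)

/-- Every program is a constant or of the form `simReset p`. -/
theorem simProgram_induction {P : Program simSignature → Prop} (hc : ∀ n, P (simConst n))
    (hr : ∀ p, P p → P (simReset p)) (p : Program simSignature) : P p := by
  induction p with
  | var v => exact v.elim
  | op f ts ih =>
    match f, ts, ih with
    | ⟨0, _⟩, ts, ih => exact eq_simReset ts ▸ hr _ (ih (0 : Fin 1))
    | ⟨n + 1, _⟩, ts, _ => exact op_succ_eq_simConst _ ts ▸ hc n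

/-! ### Compositionality of the simulating specification -/

/-- If the simulated code diverges, every program terminates in the state `0` after at most two
steps. -/
theorem step_of_not_dom {c : Code} (hc : ¬ (c.eval 0).Dom) (p : Program simSignature) :
    (∀ s, (simSpec c).step s p = (simState 0, none)) ∨
      ∃ p', (∀ s, (simSpec c).step s p' = (simState 0, none)) ∧
        ∀ s, ∃ s', (simSpec c).step s p = (s', some p') := by
  have h1 : ∀ s, (simSpec c).step s (simConst 1) = (simState 0, none) := fun s => by
    rw [step_simConst_one, haltsWithin_eq_zero hc]
  induction p using simProgram_induction with
  | hc n =>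
    match n with
    | 0 => exact .inl (step_simConst_zero c)
    | 1 => exact .inl h1
    | 2 => exact .inr ⟨_, step_simConst_zero c, fun s => ⟨_, step_simConst_two c s⟩⟩
    | n + 3 => exact .inr ⟨_, h1, fun s => ⟨_, step_simConst_add_three c s n⟩⟩
  | hr p ih =>
    -- Restoring the state alters only the intermediate state: the continuation `p'` is unchanged
    -- and ends in 0 from every state.
    rcases ih with h | ⟨p', h', h⟩
    · exact .inl fun s => step_simReset_none (h s)
    · exact .inr ⟨p', h', fun s => ⟨s, step_simReset_some (h s).choose_spec⟩⟩

theorem termination_of_not_dom {c : Code} (hc : ¬ (c.eval 0).Dom) (p : Program simSignature)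
    (s : SimState) : (simSpec c).termination p s = some (simState 0) := by
  rcases step_of_not_dom hc p with h | ⟨p', h', h⟩
  · rw [Spec.termination, Spec.trace_of_step_none (h s), finalState_nil_cons]
  · obtain ⟨s', hs⟩ := h s
    rw [Spec.termination, Spec.trace_of_step_some hs, Spec.trace_of_step_none (h' s'),
      finalState_cons_cons_nil]

/-- The trace of `simReset p` depends only on the trace of `p` if the simulated code diverges. -/
theorem trace_simReset_congr {c : Code} (hc : ¬ (c.eval 0).Dom) {p q : Program simSignature}
    (hpq : (simSpec c).trace p = (simSpec c).trace q) :
    (simSpec c).trace (simReset p) = (simSpec c).trace (simReset q) := by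
  -- Traces of lengths one and two differ, which excludes the mixed cases below.
  have ne (a a' b : SimState) : Stream'.Seq.cons a Stream'.Seq.nil ≠
      Stream'.Seq.cons a' (Stream'.Seq.cons b Stream'.Seq.nil) := by
    simp [Stream'.Seq.cons_eq_cons, Stream'.Seq.nil_ne_cons]
  funext s
  have hs := congrFun hpq s
  rcases step_of_not_dom hc p with hp | ⟨p', hp', hp⟩ <;>
    rcases step_of_not_dom hc q with hq | ⟨q', hq', hq⟩
  · rw [Spec.trace_of_step_none (step_simReset_none (hp s)),
      Spec.trace_of_step_none (step_simReset_none (hq s))]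
  · obtain ⟨t, ht⟩ := hq s
    rw [Spec.trace_of_step_none (hp s), Spec.trace_of_step_some ht,
      Spec.trace_of_step_none (hq' t)] at hs
    exact absurd hs (ne _ _ _)
  · obtain ⟨t, ht⟩ := hp s
    rw [Spec.trace_of_step_none (hq s), Spec.trace_of_step_some ht,
      Spec.trace_of_step_none (hp' t)] at hs
    exact absurd hs.symm (ne _ _ _)
  -- Both traces are `s`, 0.
  · rw [Spec.trace_of_step_some (step_simReset_some (hp s).choose_spec),
      Spec.trace_of_step_some (step_simReset_some (hq s).choose_spec),
      Spec.trace_of_step_none (hp' s), Spec.trace_of_step_none (hq' s)]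

theorem trace_simConst_two (c : Code) :
    (simSpec c).trace (simConst 2) = (simSpec c).trace (simConst 3) := by
  funext s
  rw [Spec.trace_of_step_some (step_simConst_two c s),
    Spec.trace_of_step_some (step_simConst_add_three c s 0),
    Spec.trace_of_step_none (step_simConst_zero c _),
    Spec.trace_of_step_none (step_simConst_one c _), haltsWithin_zero]

/-- Started in a state `s` that is a sufficient bound for `c`, the two programs end in 0 and 1.
Different final states also force different traces, so this serves both semantics. -/
theorem termination_simReset_ne {c : Code} (hc : (c.eval 0).Dom) :
    (simSpec c).termination (simReset (simConst 2)) ≠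
      (simSpec c).termination (simReset (simConst 3)) := by
  obtain ⟨s, hs⟩ := exists_haltsWithin_eq_one hc
  intro h
  have h := congrFun h (simState s)
  rw [Spec.termination, Spec.termination,
    Spec.trace_of_step_some (step_simReset_some (step_simConst_two c _)),
    Spec.trace_of_step_some (step_simReset_some (step_simConst_add_three c _ 0)),
    Spec.trace_of_step_none (step_simConst_zero c _),
    Spec.trace_of_step_none (step_simConst_one c _), finalState_cons_cons_nil,
    finalState_cons_cons_nil, hs] at h
  simp at h

theorem compositional_simSpec_trace (c : Code) :
    Compositional (simSpec c).trace ↔ ¬ (c.eval 0).Dom := by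
  constructor
  · intro h hc
    have := h (simOp 0) (fun _ => simConst 2) (fun _ => simConst 3) fun _ => trace_simConst_two c
    exact termination_simReset_ne hc (funext fun s => congrArg finalState (congrFun this s))
  · intro hc f p q h
    match f, p, q, h with
    | ⟨0, _⟩, p, q, h =>
      rw [eq_simReset p, eq_simReset q]
      exact trace_simReset_congr hc (h (0 : Fin 1))
    | ⟨n + 1, _⟩, p, q, _ => rw [op_succ_eq_simConst _ p, op_succ_eq_simConst _ q]

theorem compositional_simSpec_termination (c : Code) :
    Compositional (simSpec c).termination ↔ ¬ (c.eval 0).Dom := by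
  constructor
  · intro h hc
    exact termination_simReset_ne hc (h (simOp 0) (fun _ => simConst 2) (fun _ => simConst 3)
      fun _ => funext fun s => congrArg finalState (congrFun (trace_simConst_two c) s))
  · intro hc f p q _
    funext s
    -- All programs have the same termination semantics.
    rw [termination_of_not_dom hc, termination_of_not_dom hc]

/-! ### The reduction -/

/-- The simulating specifications are primitive recursive, with descriptions that can be computed
from the simulated codes. -/
theorem exists_primrecSpec : ∃ D : Code → Description, Computable D ∧ ∀ c, ∃ P : PrimrecSpec,
    P.description = D c ∧
    (Compositional P.spec.trace ↔ Compositional (simSpec c).trace) ∧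
    (Compositional P.spec.termination ↔ Compositional (simSpec c).termination) := by
  obtain ⟨one, ho, eo⟩ := exists_searchFree_code (f := fun _ => 1)
    (Primrec.nat_iff.1 (Primrec.const 1))
  obtain ⟨ar, ha, ea⟩ := exists_searchFree_code (f := fun n => 1 - n)
    (Primrec.nat_iff.1 (Primrec.nat_sub.comp (Primrec.const 1) Primrec.id))
  obtain ⟨r, hr, er⟩ := exists_searchFree_code primrec_simRuleNat
  -- One fixed definition `r` serves all codes; currying inserts the encoding of `c` computably and
  -- adds no search.
  refine ⟨fun c => (one, ar, one, r.curry (encode c)), ?_, fun c => ?_⟩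
  · exact (Primrec.pair (Primrec.const one) (Primrec.pair (Primrec.const ar)
      (Primrec.pair (Primrec.const one)
        (Code.primrec₂_curry.comp (Primrec.const r) Primrec.encode)))).to_comp
  · let P : PrimrecSpec :=
      { isOp := ⟨one, ho, fun _ => 1, eo⟩
        ar := ⟨ar, ha, fun n => 1 - n, ea⟩
        isState := ⟨one, ho, fun _ => 1, eo⟩
        ruleFun := ⟨r.curry (encode c), searchFree_curry hr _,
          fun n => simRuleNat (Nat.pair (encode c) n), fun n => by rw [Code.eval_curry, er]⟩
        spec := simSpec c
        ruleFun_eq := by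
          intro f s τ
          dsimp only
          have := simRuleNat_encodeTrigger c f s τ
          exact this }
    exact ⟨P, rfl, Iff.rfl, Iff.rfl⟩

/-- A property of specifications that expresses the divergence of codes is undecidable. -/
theorem not_decidableForSpecs_of_reduction {Q : PrimrecSpec → Prop} {D : Code → Description}
    (hD : Computable D)
    (hQ : ∀ c, ∃ P : PrimrecSpec, P.description = D c ∧ (Q P ↔ ¬ (c.eval 0).Dom)) :
    ¬ DecidableForSpecs Q := by
  rintro ⟨d, hd, h⟩
  have key : ∀ c, ∃ b : Bool, b ∈ d (D c) ∧ (b = true ↔ ¬ (c.eval 0).Dom) := fun c => by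
    obtain ⟨P, hP, hPQ⟩ := hQ c
    obtain ⟨b, hb, hb'⟩ := h P
    exact ⟨b, hP ▸ hb, hb'.trans hPQ⟩
  -- Although `d` may diverge elsewhere, it answers on all values of `D`. The resulting total
  -- function `g` is computable, and its negation would decide halting on input 0.
  choose g hg hg' using key
  refine ComputablePred.halting_problem 0 (ComputablePred.computable_iff.2
    ⟨fun c => !g c, Primrec.not.to_comp.comp ?_, ?_⟩)
  · exact (hd.comp hD).of_eq fun c => Part.eq_some_iff.2 (hg c)
  · funext c
    have := hg' c
    cases hc : g c <;> simp_all

end SSOS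

theorem mainTheorem3 :
    (¬ SSOS.DecidableForSpecs fun P => SSOS.Compositional P.spec.trace) ∧
    (¬ SSOS.DecidableForSpecs fun P => SSOS.Compositional P.spec.termination) := by
  obtain ⟨D, hD, h⟩ := SSOS.exists_primrecSpec
  refine ⟨SSOS.not_decidableForSpecs_of_reduction hD fun c => ?_,
    SSOS.not_decidableForSpecs_of_reduction hD fun c => ?_⟩
  · obtain ⟨P, hP, ht, -⟩ := h c
    exact ⟨P, hP, ht.trans (SSOS.compositional_simSpec_trace c)⟩
  · obtain ⟨P, hP, -, ht⟩ := h c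
    exact ⟨P, hP, ht.trans (SSOS.compositional_simSpec_termination c)⟩
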